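/- Let $X$ be a compact metric space with metric $d$ and let $T:X\to X$ be a homeomorphism such that $(X,T)$ is totally uniquely ergodic, i.e. for every integer $m\ge 1$ there is exactly one $T^m$-invariant Borel probability measure on $X$. Let $\mu$ be the unique $T$-invariant Borel probability measure. Let $C\ge 2$ be an integer, let $k\in\mathbb{N}$, and let $(q_n)$ be a strictly increasing sequence of natural numbers such that 1. $\omega(q_n)\le k$ for all $n$, where $\omega(m)$ is the number of distinct prime divisors of $m$; 2. $\displaystyle \lim_{n\to\infty}\ \max_{0\le t<q_n^{C-1}}\ \sup_{x\in X} d\left(x,T^{tq_n}x\right)=0$. Then for every continuous function $f:X\to\mathbb{C}$, $$\lim_{n\to\infty}\frac{1}{q_n}\sum_{0\le i<q_n} f\left(T^{i^C}x\right)=\int_X f\,d\mu \qquad\text{uniformly in } x\in X .$$ Consequently, for every $x\in X$ the closure of $\{T^{n^C}x : n\in\mathbb{N}\}$ contains the support of $\mu$; in particular, if $\mu$ has full support (every non-empty open set has positive measure), then $\{T^{n^C}x : n\in\mathbb{N}\}$ is dense in $X$ for every $x\in X$. -/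

import Mathlib

open Filter Topology MeasureTheory

/-- A self-map `T` is uniquely ergodic if exactly one probability measure (on the given
sigma-algebra, the Borel one in the theorem) is `T`-invariant. -/
def IsUniquelyErgodic {X : Type*} [MeasurableSpace X] (T : X → X) : Prop :=
  ∃! μ : Measure X, IsProbabilityMeasure μ ∧ MeasurePreserving T μ μ

/-- `T` is totally uniquely ergodic if every power `T^n`, `n ≥ 1`, is uniquely ergodic. -/
def IsTotallyUniquelyErgodic {X : Type*} [MeasurableSpace X] (T : X → X) : Prop :=
  ∀ n : ℕ, 0 < n → IsUniquelyErgodic (T^[n])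

/-- `max_{t < M} sup_x d(x, T^{t q} x)`. -/
noncomputable def rigidityDefect {X : Type*} [MetricSpace X] (T : X → X) (q M : ℕ) : ℝ :=
  ⨆ t : Fin M, ⨆ x : X, dist x (T^[(t : ℕ) * q] x)

/-! Subtract the integral from `f`. Rigidity at a time `r = q n` makes `N ↦ f (T^[N] x)` nearly
`r`-periodic for `N < r ^ C`, so the average along `C`-th powers becomes a sum of `G (a ^ C)` over
`ZMod r`. Two facts about `G` are available. Its averages over cosets of `D · ZMod r`, with `D`
bounded, are Birkhoff averages of `T^[D]`, hence small by total unique ergodicity. And `G` is nearly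
invariant under translation by `h * Q * D`, where `Q` is an earlier, fixed member of the sequence.

Since `r` has at most `k` prime factors, along a subsequence they lie in a fixed finite set `S` or
tend to infinity. Write `r = s * m` accordingly and use the Chinese remainder theorem. Modulo `s`, a
Hensel-type argument spreads `C`-th powers evenly over cosets of bounded index, apart from few
residues (`exists_norm_sum_comp_pow_le`). Modulo `m`, powers are expanded in the at most `C ^ k`
characters of order dividing `C`. The trivial one gives a mean of `G`; each other one is almost
orthogonal to its translates by units, so a nearly invariant function barely correlates with it
(`norm_sum_mul_mulChar_le`). -/

/-! ### Uniform Birkhoff averages in uniquely ergodic systems. -/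

/-- The empirical measure of the first `L` points of the orbit of `x`. -/
noncomputable def empiricalMeasure {X : Type*} [MeasurableSpace X] (T : X → X) (L : ℕ) (x : X) :
    Measure X :=
  (L : ENNReal)⁻¹ • ∑ t ∈ Finset.range L, Measure.dirac (T^[t] x)

theorem isProbabilityMeasure_empiricalMeasure {X : Type*} [MeasurableSpace X] (T : X → X)
    {L : ℕ} (hL : 0 < L) (x : X) : IsProbabilityMeasure (empiricalMeasure T L x) := by
  constructor
  simp only [empiricalMeasure, Measure.smul_apply, Measure.finsetSum_apply, measure_univ,
    Finset.sum_const, Finset.card_range, nsmul_eq_mul, mul_one, smul_eq_mul]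
  exact ENNReal.inv_mul_cancel (by exact_mod_cast hL.ne') (ENNReal.natCast_ne_top L)

theorem integral_empiricalMeasure {X : Type*} [TopologicalSpace X] [CompactSpace X]
    [MeasurableSpace X] [BorelSpace X] {E : Type*} [NormedAddCommGroup E] [NormedSpace ℝ E]
    [SecondCountableTopology E] [CompleteSpace E]
    (T : X → X) (L : ℕ) (x : X) {g : X → E} (hg : Continuous g) :
    ∫ y, g y ∂(empiricalMeasure T L x) =
      (L : ℝ)⁻¹ • ∑ t ∈ Finset.range L, g (T^[t] x) := by
  borelize E
  have hm : StronglyMeasurable g := hg.stronglyMeasurable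
  have hint : ∀ t ∈ Finset.range L, Integrable g (Measure.dirac (T^[t] x)) := fun t _ =>
    integrable_dirac' hm (by simp)
  rw [empiricalMeasure, integral_smul_measure, integral_finsetSum_measure hint]
  congr 1
  · simp
  · exact Finset.sum_congr rfl fun t _ => integral_dirac' g _ hm

/-- In a uniquely ergodic system the Birkhoff averages of a continuous function converge
uniformly to its integral. -/
theorem IsUniquelyErgodic.birkhoff_uniform {X : Type*} [MetricSpace X] [CompactSpace X]
    [MeasurableSpace X] [BorelSpace X] {T : X → X} (hT : IsUniquelyErgodic T)
    (hTc : Continuous T) {μ : Measure X} [IsProbabilityMeasure μ] (hμ : MeasurePreserving T μ μ)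
    (f : C(X, ℂ)) {ε : ℝ} (hε : 0 < ε) :
    ∃ L₀ : ℕ, ∀ L ≥ L₀, ∀ x : X,
      ‖∑ t ∈ Finset.range L, f (T^[t] x) - L * ∫ y, f y ∂μ‖ ≤ ε * L := by
  by_contra! hcon
  choose L hL x hx using fun n : ℕ => hcon (n + 1)
  have hLpos : ∀ n, 0 < L n := fun n => lt_of_lt_of_le n.succ_pos (hL n)
  have hLtop : Tendsto (fun n => (L n : ℝ)) (hyperfilter ℕ : Filter ℕ) atTop := by
    refine Tendsto.mono_left ?_ Nat.hyperfilter_le_atTop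
    refine tendsto_natCast_atTop_atTop.comp (tendsto_atTop_mono (fun n => ?_) tendsto_id)
    exact (Nat.le_succ n).trans (hL n)
  let ν : ℕ → ProbabilityMeasure X := fun n =>
    ⟨empiricalMeasure T (L n) (x n), isProbabilityMeasure_empiricalMeasure T (hLpos n) (x n)⟩
  -- Weak compactness yields a limit along an ultrafilter, so no subsequence has to be extracted.
  -- The limit will be invariant, hence equal to `μ`.
  obtain ⟨ρ, -, hρ⟩ := isCompact_univ.ultrafilter_le_nhds ((hyperfilter ℕ).map ν) (by simp)
  have hlim : Tendsto ν (hyperfilter ℕ : Filter ℕ) (𝓝 ρ) := hρ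
  rw [ProbabilityMeasure.tendsto_iff_forall_integral_tendsto] at hlim
  have hreal : ∀ g : X → ℝ, Continuous g →
      Tendsto (fun n => (L n : ℝ)⁻¹ * ∑ t ∈ Finset.range (L n), g (T^[t] (x n)))
        (hyperfilter ℕ : Filter ℕ) (𝓝 (∫ y, g y ∂(ρ : Measure X))) := by
    intro g hg
    have := hlim (BoundedContinuousFunction.mkOfCompact ⟨g, hg⟩)
    refine this.congr fun n => ?_
    exact integral_empiricalMeasure T (L n) (x n) hg
  have hinv : MeasurePreserving T (ρ : Measure X) ρ := by
    refine ⟨hTc.measurable, ?_⟩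
    have : IsProbabilityMeasure (Measure.map T (ρ : Measure X)) :=
      Measure.isProbabilityMeasure_map hTc.measurable.aemeasurable
    refine ext_of_forall_integral_eq_of_IsFiniteMeasure fun g => ?_
    rw [integral_map hTc.measurable.aemeasurable g.continuous.aestronglyMeasurable]
    have h1 := hreal _ (g.continuous.comp hTc)
    have h2 := hreal _ g.continuous
    -- The averages of `g ∘ T` and `g` differ only by this telescoped boundary term.
    have h3 : Tendsto (fun n => (L n : ℝ)⁻¹ * (g (T^[L n] (x n)) - g (x n)))
        (hyperfilter ℕ : Filter ℕ) (𝓝 0) := by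
      refine squeeze_zero_norm (a := fun n => (L n : ℝ)⁻¹ * (2 * ‖g‖)) (fun n => ?_) ?_
      · rw [norm_mul, norm_inv, Real.norm_natCast]
        gcongr
        refine (norm_sub_le _ _).trans ?_
        linarith [g.norm_coe_le_norm (T^[L n] (x n)), g.norm_coe_le_norm (x n)]
      · simpa using (tendsto_inv_atTop_zero.comp hLtop).mul_const (2 * ‖g‖)
    have h4 := h2.add h3
    rw [add_zero] at h4
    refine tendsto_nhds_unique h1 (h4.congr fun n => ?_)
    have h5 := Finset.sum_range_succ (fun t => g (T^[t] (x n))) (L n)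
    rw [Finset.sum_range_succ'] at h5
    simp only [Function.comp_apply, ← Function.iterate_succ_apply', Function.iterate_zero,
      id] at h5 ⊢
    rw [← mul_add]
    congr 1
    linarith
  have hρμ : (ρ : Measure X) = μ := hT.unique ⟨inferInstance, hinv⟩ ⟨inferInstance, hμ⟩
  have hfi : Integrable f μ := f.continuous.integrable_of_hasCompactSupport
    (HasCompactSupport.of_compactSpace f)
  have hre := hreal _ (Complex.continuous_re.comp f.continuous)
  have him := hreal _ (Complex.continuous_im.comp f.continuous)
  rw [hρμ] at hre him
  have hcx : Tendsto (fun n => (L n : ℂ)⁻¹ * ∑ t ∈ Finset.range (L n), f (T^[t] (x n)))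
      (hyperfilter ℕ : Filter ℕ) (𝓝 (∫ y, f y ∂μ)) := by
    have := ((Complex.continuous_ofReal.tendsto _).comp hre).add
      (((Complex.continuous_ofReal.tendsto _).comp him).mul_const Complex.I)
    have hval := integral_re_add_im (𝕜 := ℂ) hfi
    simp only [Complex.coe_algebraMap, RCLike.re_to_complex, RCLike.im_to_complex,
      RCLike.I_to_complex] at hval
    rw [← hval]
    refine this.congr fun n => ?_
    apply Complex.ext <;> simp [← Complex.ofReal_natCast, ← Complex.ofReal_inv]
  have hev := (Metric.tendsto_nhds.1 hcx ε hε).exists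
  obtain ⟨n, hn⟩ := hev
  have hLn : (0 : ℝ) < L n := by exact_mod_cast hLpos n
  have hLn' : (L n : ℂ) ≠ 0 := by exact_mod_cast (hLpos n).ne'
  refine absurd (hx n) (not_lt.2 ?_)
  have : ∑ t ∈ Finset.range (L n), f (T^[t] (x n)) - L n * ∫ y, f y ∂μ =
      L n * ((L n : ℂ)⁻¹ * ∑ t ∈ Finset.range (L n), f (T^[t] (x n)) - ∫ y, f y ∂μ) := by
    field_simp
  rw [this, norm_mul, Complex.norm_natCast, mul_comm]
  rw [dist_eq_norm] at hn
  gcongr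

/-! ### Power sums modulo numbers supported on a fixed set of primes. -/

open Polynomial in
/-- The binomial expansion of `(1 + X) ^ n` to first order. -/
theorem exists_one_add_X_pow_eq {R : Type*} [CommRing R] (n : ℕ) :
    ∃ Z : R[X], (1 + X) ^ n = 1 + (n : R[X]) * X + X ^ 2 * Z := by
  induction n with
  | zero => exact ⟨0, by simp⟩
  | succ n ih =>
    obtain ⟨Z, hZ⟩ := ih
    refine ⟨Z * (1 + X) + (n : R[X]), ?_⟩
    rw [pow_succ, hZ]
    push_cast
    ring

open Polynomial in
/-- In a finite ring with `N` nilpotent, every element of `1 + n²N R` is the `n`-th power of a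
unit. -/
theorem exists_isUnit_pow_eq {R : Type*} [CommRing R] [Finite R] {N : R} (hN : IsNilpotent N)
    (n : ℕ) (y : R) : ∃ w : R, IsUnit w ∧ w ^ n = 1 + n ^ 2 * N * y := by
  obtain ⟨Z, hZ⟩ := exists_one_add_X_pow_eq (R := R) n
  -- With `w = 1 + n * N * t` the expansion gives `w ^ n = 1 + n ^ 2 * N * φ t`, so it suffices to
  -- solve `φ t = y`. Differences of values of `φ` are differences of arguments times a unit `1 + N
  -- * c`, so `φ` is injective, hence surjective by finiteness.
  let A : R[X] := X ^ 2 * Z.comp (C (n * N) * X)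
  let φ : R → R := fun t => t + N * A.eval t
  have hφ : Function.Injective φ := by
    intro t t' h
    obtain ⟨c, hc⟩ := sub_dvd_eval_sub t t' A
    have hu : IsUnit (1 + N * c) := IsNilpotent.isUnit_one_add (Commute.isNilpotent_mul_right
      (Commute.all _ _) hN)
    have h0 : (t - t') * (1 + N * c) = 0 := by
      have h' : t + N * A.eval t = t' + N * A.eval t' := h
      linear_combination h' - N * hc
    exact sub_eq_zero.1 ((hu.mul_left_eq_zero).1 h0)
  obtain ⟨t, ht⟩ := Finite.surjective_of_injective hφ y
  refine ⟨1 + n * N * t, ?_, ?_⟩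
  · refine IsNilpotent.isUnit_one_add ?_
    rw [mul_right_comm]
    exact Commute.isNilpotent_mul_left (Commute.all _ _) hN
  · have h1 := congrArg (Polynomial.eval (n * N * t)) hZ
    simp only [eval_pow, eval_add, eval_one, eval_X, eval_mul, eval_natCast] at h1
    have h2 : t + N * (t ^ 2 * Z.eval (n * N * t)) = y := by
      simpa [φ, A, eval_comp] using ht
    rw [h1, ← h2]
    ring

/-- Multiplication by a unit `w` with `w ^ n = 1 + n ^ 2 * N * y` permutes the summation variable.
-/
theorem sum_comp_pow_eq_sum_add_mul {R : Type*} [CommRing R] [Fintype R] {N : R}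
    (hN : IsNilpotent N) (n : ℕ) (F : R → ℂ) (y : R) :
    ∑ i, F (i ^ n) = ∑ i, F (i ^ n + n ^ 2 * N * i ^ n * y) := by
  obtain ⟨w, hw, hwn⟩ := exists_isUnit_pow_eq hN n y
  rw [← Equiv.sum_comp (Units.mulLeft hw.unit)]
  refine Finset.sum_congr rfl fun i _ => ?_
  simp only [Units.mulLeft_apply, IsUnit.unit_spec, mul_pow, hwn]
  congr 1
  ring

/-- Averaging the preceding identity over `y` trades the sparse set of `n`-th powers for cosets of
the ideals generated by `n ^ 2 * N * i ^ n`. -/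
theorem card_mul_norm_sum_comp_pow_le {R : Type*} [CommRing R] [Fintype R] {N : R}
    (hN : IsNilpotent N) (n : ℕ) (F : R → ℂ) :
    Fintype.card R * ‖∑ i, F (i ^ n)‖ ≤
      ∑ i : R, ‖∑ y, F (i ^ n + n ^ 2 * N * i ^ n * y)‖ := by
  have h : (Fintype.card R : ℂ) * ∑ i, F (i ^ n) =
      ∑ i, ∑ y, F (i ^ n + n ^ 2 * N * i ^ n * y) := by
    rw [Finset.sum_comm, ← Finset.card_univ, ← nsmul_eq_mul, ← Finset.sum_const]
    exact Finset.sum_congr rfl fun y _ => sum_comp_pow_eq_sum_add_mul hN n F y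
  rw [← Complex.norm_natCast, ← norm_mul, h]
  exact norm_sum_le _ _

theorem isNilpotent_natCast_prod_of_primeFactors_subset {s : ℕ} (hs : s ≠ 0) {S : Finset ℕ}
    (h : s.primeFactors ⊆ S) : IsNilpotent (((∏ p ∈ S, p : ℕ)) : ZMod s) := by
  refine ⟨s, ?_⟩
  rw [← Nat.cast_pow, ZMod.natCast_eq_zero_iff]
  calc s = ∏ p ∈ s.primeFactors, p ^ s.factorization p :=
        (Nat.prod_factorization_pow_eq_self hs).symm
    _ ∣ ∏ p ∈ s.primeFactors, p ^ s :=
        Finset.prod_dvd_prod_of_dvd _ _ fun p _ =>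
          pow_dvd_pow _ (Nat.factorization_lt p hs).le
    _ ∣ ∏ p ∈ S, p ^ s := Finset.prod_dvd_prod_of_subset _ _ _ h
    _ = (∏ p ∈ S, p) ^ s := Finset.prod_pow _ _ _

theorem dvd_mul_gcd_pow_of_dvd {d a i n s : ℕ} (hs : d ∣ s) (h : d ∣ a * i ^ n) :
    d ∣ a * (Nat.gcd i s) ^ n := by
  have h1 : d ∣ a * Nat.gcd (i ^ n) (s ^ n) := by
    rcases Nat.eq_zero_or_pos n with rfl | hn
    · simpa using h
    rw [← Nat.gcd_mul_left]
    exact Nat.dvd_gcd h (Dvd.dvd.mul_left (hs.trans (dvd_pow_self s hn.ne')) a)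
  rwa [Nat.pow_gcd_pow] at h1

/-- The reciprocals of the numbers composed of primes in `S` are summable, by the finite Euler
product. -/
theorem exists_tail_inv_le (S : Finset ℕ) {ε : ℝ} (hε : 0 < ε) :
    ∃ B : ℕ, ∀ t : Finset ℕ, (∀ δ ∈ t, δ ∈ Nat.factoredNumbers S ∧ B < δ) →
      ∑ δ ∈ t, (δ : ℝ)⁻¹ ≤ ε := by
  let f : ℕ →* ℝ :=
    { toFun := fun n => (n : ℝ)⁻¹
      map_one' := by simp
      map_mul' := fun a b => by push_cast; rw [mul_inv] }
  have hsum := (EulerProduct.summable_and_hasSum_factoredNumbers_prod_filter_prime_geometric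
    (f := f) (fun {p} hp => by
      have : (1 : ℝ) < p := by exact_mod_cast hp.one_lt
      simpa [f] using inv_lt_one_of_one_lt₀ this) S).2.summable
  have hsum' : Summable ((Nat.factoredNumbers S).indicator fun n : ℕ => (n : ℝ)⁻¹) :=
    (summable_subtype_iff_indicator (f := fun n : ℕ => (n : ℝ)⁻¹)).1 hsum
  obtain ⟨t₀, ht₀⟩ := summable_iff_vanishing_norm.1 hsum' ε hε
  refine ⟨t₀.sup id, fun t ht => ?_⟩
  have h1 := ht₀ t (Finset.disjoint_left.2 fun δ hδ hδ' =>
    absurd (Finset.le_sup (f := id) hδ') (not_le.2 (ht δ hδ).2))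
  rw [Finset.sum_congr rfl fun δ hδ => Set.indicator_of_mem (ht δ hδ).1 _] at h1
  exact (le_abs_self _).trans h1.le

theorem card_filter_dvd_val_le {s : ℕ} [NeZero s] {δ : ℕ} (hδ : δ ∣ s) :
    (((Finset.univ : Finset (ZMod s)).filter fun i => δ ∣ i.val).card : ℝ) ≤ s * (δ : ℝ)⁻¹ := by
  obtain ⟨e, he⟩ := hδ
  have hs := NeZero.ne s
  have hδ0 : δ ≠ 0 := by rintro rfl; simp at he; exact hs he
  have h1 : ((Finset.univ : Finset (ZMod s)).filter fun i => δ ∣ i.val).card ≤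
      (Finset.range e).card := by
    refine Finset.card_le_card_of_injOn (fun i => i.val / δ) ?_ ?_
    · intro i _
      simp only [Finset.coe_range, Set.mem_Iio]
      refine Nat.div_lt_of_lt_mul ?_
      rw [← he]
      exact ZMod.val_lt i
    · intro i hi j hj hij
      simp only [Finset.coe_filter, Finset.mem_univ, true_and, Set.mem_ofPred_eq] at hi hj
      have hij' : i.val / δ = j.val / δ := hij
      refine ZMod.val_injective s ?_
      rw [← Nat.div_mul_cancel hi, ← Nat.div_mul_cancel hj, hij']
  rw [Finset.card_range] at h1
  have h2 : (s : ℝ) * (δ : ℝ)⁻¹ = e := by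
    have : (δ : ℝ) ≠ 0 := by exact_mod_cast hδ0
    rw [he]; push_cast; field_simp
  rw [h2]
  exact_mod_cast h1

/-- For moduli supported on a fixed finite set of primes, all but a small proportion of residues
have a bounded greatest common divisor with the modulus. -/
theorem exists_card_gcd_gt_le (S : Finset ℕ) {ε : ℝ} (hε : 0 < ε) :
    ∃ B : ℕ, ∀ (s : ℕ) [NeZero s], s.primeFactors ⊆ S →
      (((Finset.univ : Finset (ZMod s)).filter fun i => B < Nat.gcd i.val s).card : ℝ) ≤ ε * s := by
  obtain ⟨B, hB⟩ := exists_tail_inv_le S hε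
  refine ⟨B, fun s _ hs => ?_⟩
  have hs0 := NeZero.ne s
  have hsub : ((Finset.univ : Finset (ZMod s)).filter fun i => B < Nat.gcd i.val s) ⊆
      (s.divisors.filter fun δ => B < δ).biUnion fun δ =>
        (Finset.univ : Finset (ZMod s)).filter fun i => δ ∣ i.val := by
    intro i hi
    simp only [Finset.mem_filter, Finset.mem_univ, true_and, Finset.mem_biUnion,
      Nat.mem_divisors] at hi ⊢
    exact ⟨Nat.gcd i.val s, ⟨⟨Nat.gcd_dvd_right _ _, hs0⟩, hi⟩, Nat.gcd_dvd_left _ _⟩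
  calc (((Finset.univ : Finset (ZMod s)).filter fun i => B < Nat.gcd i.val s).card : ℝ)
      ≤ ∑ δ ∈ s.divisors.filter fun δ => B < δ,
          (((Finset.univ : Finset (ZMod s)).filter fun i => δ ∣ i.val).card : ℝ) := by
        exact_mod_cast (Finset.card_le_card hsub).trans Finset.card_biUnion_le
    _ ≤ ∑ δ ∈ s.divisors.filter fun δ => B < δ, s * (δ : ℝ)⁻¹ :=
        Finset.sum_le_sum fun δ hδ => card_filter_dvd_val_le
          (Nat.dvd_of_mem_divisors (Finset.mem_filter.1 hδ).1)
    _ = s * ∑ δ ∈ s.divisors.filter fun δ => B < δ, (δ : ℝ)⁻¹ := by rw [Finset.mul_sum]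
    _ ≤ s * ε := by
        gcongr
        refine hB _ fun δ hδ => ?_
        rw [Finset.mem_filter, Nat.mem_divisors] at hδ
        refine ⟨⟨ne_zero_of_dvd_ne_zero hs0 hδ.1.1, fun p hp => hs ?_⟩, hδ.2⟩
        exact Nat.primeFactors_mono hδ.1.1 hs0 (List.mem_toFinset.2 hp)
    _ = ε * s := mul_comm _ _

/-- Let `s` be supported on a fixed finite set of primes. A function on `ZMod s` with small
averages over all cosets of bounded index has a small average along `n`-th powers. -/
theorem exists_norm_sum_comp_pow_le (S : Finset ℕ) (hS : ∀ p ∈ S, p ≠ 0) (n : ℕ) (hn : n ≠ 0)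
    {ε : ℝ} (hε : 0 < ε) :
    ∃ Dmax : ℕ, ∀ (s : ℕ) [NeZero s], s.primeFactors ⊆ S → ∀ (F : ZMod s → ℂ) (M δ : ℝ),
      0 ≤ δ → (∀ a, ‖F a‖ ≤ M) →
      (∀ D : ℕ, D ∣ s → D ≤ Dmax → ∀ r, ‖∑ y, F (r + D * y)‖ ≤ δ * s) →
      ‖∑ i, F (i ^ n)‖ ≤ (δ + ε * M) * s := by
  obtain ⟨B, hB⟩ := exists_card_gcd_gt_le S hε
  set N : ℕ := ∏ p ∈ S, p with hN
  have hN0 : N ≠ 0 := Finset.prod_ne_zero_iff.2 hS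
  -- The ideal generated by `n ^ 2 * N * i ^ n` has a generator `D ∣ s` dividing `n ^ 2 * N * gcd(i,
  -- s) ^ n`; the gcd is at most `B` for all but a proportion `ε` of the `i`.
  refine ⟨n ^ 2 * N * B ^ n, fun s _ hs F M δ hδ hM hF => ?_⟩
  have hs0 : (0 : ℝ) < s := by exact_mod_cast NeZero.pos s
  have hM0 : 0 ≤ M := (norm_nonneg _).trans (hM 0)
  have hnil := isNilpotent_natCast_prod_of_primeFactors_subset (NeZero.ne s) hs
  have h1 := card_mul_norm_sum_comp_pow_le hnil n F
  rw [ZMod.card, ← hN] at h1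
  have hgood : ∀ i : ZMod s, ¬ B < Nat.gcd i.val s →
      ‖∑ y, F (i ^ n + n ^ 2 * N * i ^ n * y)‖ ≤ δ * s := by
    intro i hi
    obtain ⟨D, hD, u, hu, hDu⟩ := ZMod.eq_unit_mul_divisor ((n : ZMod s) ^ 2 * (N : ZMod s) * i ^ n)
    have hdvd : D ∣ n ^ 2 * N * i.val ^ n := by
      have h2 := congrArg (ZMod.castHom hD (ZMod D)) hDu
      rw [map_mul _ u, map_natCast, ZMod.natCast_self, mul_zero] at h2
      simp only [map_mul, map_pow, map_natCast, ZMod.castHom_apply] at h2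
      rw [← ZMod.natCast_eq_zero_iff]
      push_cast
      rw [ZMod.natCast_val]
      exact h2
    have hle : D ≤ n ^ 2 * N * B ^ n := by
      have hpos : 0 < n ^ 2 * N * Nat.gcd i.val s ^ n :=
        Nat.mul_pos (Nat.mul_pos (pow_pos (Nat.pos_of_ne_zero hn) 2) (Nat.pos_of_ne_zero hN0))
          (pow_pos (Nat.gcd_pos_of_pos_right _ (NeZero.pos s)) _)
      refine (Nat.le_of_dvd hpos (dvd_mul_gcd_pow_of_dvd hD hdvd)).trans ?_
      gcongr
      exact not_lt.1 hi
    have h3 := hF D hD hle (i ^ n)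
    rw [← Equiv.sum_comp (Units.mulLeft hu.unit)] at h3
    refine le_of_eq_of_le (congrArg _ (Finset.sum_congr rfl fun y _ => congrArg F ?_)) h3
    rw [hDu]
    simp only [Units.mulLeft_apply, IsUnit.unit_spec]
    ring
  have hbad : ∀ i : ZMod s, ‖∑ y, F (i ^ n + n ^ 2 * N * i ^ n * y)‖ ≤ s * M := by
    intro i
    refine (norm_sum_le_of_le _ fun y _ => hM _).trans ?_
    simp [ZMod.card]
  have h4 : ∑ i : ZMod s, ‖∑ y, F (i ^ n + n ^ 2 * N * i ^ n * y)‖ ≤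
      ∑ i : ZMod s, (δ * s + if B < Nat.gcd i.val s then s * M else 0) := by
    refine Finset.sum_le_sum fun i _ => ?_
    split_ifs with hi
    · have := hbad i
      have : 0 ≤ δ * s := by positivity
      linarith
    · simpa using hgood i hi
  rw [Finset.sum_add_distrib, ← Finset.sum_filter] at h4
  simp only [Finset.sum_const, Finset.card_univ, ZMod.card, nsmul_eq_mul] at h4
  have h5 := mul_le_mul_of_nonneg_right (hB s hs) (mul_nonneg hs0.le hM0)
  refine le_of_mul_le_mul_left (h1.trans (h4.trans ?_)) hs0
  nlinarith

/-! ### Characters and power sums modulo numbers with few, large prime factors. -/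

/-- The number of non-units of a finite ring. -/
noncomputable def nonunitCount (R : Type*) [CommRing R] : ℕ := Nat.card {a : R // ¬ IsUnit a}

theorem nonunitCount_eq_card_filter (R : Type*) [CommRing R] [Fintype R]
    [DecidablePred fun a : R => IsUnit a] :
    nonunitCount R = (Finset.univ.filter fun a : R => ¬ IsUnit a).card := by
  rw [nonunitCount, Nat.card_eq_fintype_card, Fintype.card_subtype]

theorem sum_eq_sum_units_add {R : Type*} [CommRing R] [Fintype R] [DecidableEq R]
    [DecidablePred fun a : R => IsUnit a] (A : R → ℂ) :
    ∑ a, A a = ∑ u : Rˣ, A u + ∑ a : R with ¬ IsUnit a, A a := by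
  rw [← Finset.sum_filter_add_sum_filter_not _ (fun a : R => IsUnit a)]
  congr 1
  symm
  refine Finset.sum_bij (fun (u : Rˣ) _ => (u : R)) ?_ ?_ ?_ ?_
  · intro u _; simp
  · intro u _ u' _ h; exact Units.ext h
  · intro b hb
    obtain ⟨u, rfl⟩ := (Finset.mem_filter.1 hb).2
    exact ⟨u, Finset.mem_univ _, rfl⟩
  · intro u _; rfl

theorem norm_sum_sub_sum_units_le {R : Type*} [CommRing R] [Fintype R] [DecidableEq R] (A : R → ℂ) {M : ℝ}
    (hA : ∀ a, ‖A a‖ ≤ M) : ‖∑ a, A a - ∑ u : Rˣ, A u‖ ≤ nonunitCount R * M := by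
  have : DecidablePred fun a : R => IsUnit a := Classical.decPred _
  rw [sum_eq_sum_units_add, add_sub_cancel_left, nonunitCount_eq_card_filter, ← nsmul_eq_mul,
    ← Finset.sum_const]
  exact norm_sum_le_of_le _ fun a _ => hA a

theorem MulChar.sum_eq_sum_units {R : Type*} [CommRing R] [Fintype R] [DecidableEq R]
    (χ : MulChar R ℂ) (A : R → ℂ) : ∑ a, A a * χ a = ∑ u : Rˣ, A u * χ u := by
  have : DecidablePred fun a : R => IsUnit a := Classical.decPred _
  rw [sum_eq_sum_units_add, add_eq_left]
  refine Finset.sum_eq_zero fun a ha => ?_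
  rw [χ.map_nonunit (Finset.mem_filter.1 ha).2, mul_zero]

theorem MulChar.norm_apply_le_one {R : Type*} [CommRing R] [Finite R] (χ : MulChar R ℂ) (a : R) :
    ‖χ a‖ ≤ 1 := by
  by_cases ha : IsUnit a
  · obtain ⟨u, rfl⟩ := ha
    refine (IsOfFinOrder.norm_eq_one ?_).le
    exact MonoidHom.isOfFinOrder (χ.toMonoidHom.comp (Units.coeHom R)) (isOfFinOrder_of_finite u)
  · rw [χ.map_nonunit ha, norm_zero]
    exact zero_le_one

/-- A nontrivial multiplicative character is almost orthogonal to its translate by a unit. -/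
theorem MulChar.norm_sum_mul_star_translate_le {R : Type*} [CommRing R] [Fintype R]
    {χ : MulChar R ℂ} (hχ : χ ≠ 1) {v : R} (hv : IsUnit v) :
    ‖∑ b, χ b * star (χ (b + v))‖ ≤ nonunitCount R := by
  classical
  obtain ⟨v, rfl⟩ := hv
  have h1 : ∑ b, χ b * star (χ (b + v)) = ∑ u : Rˣ, χ (1 - u) := by
    calc ∑ b, χ b * star (χ (b + v)) = ∑ c, χ (c - v) * (χ⁻¹) c := by
          rw [← Equiv.sum_comp (Equiv.addRight (v : R)) fun c => χ (c - v) * (χ⁻¹) c]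
          refine Finset.sum_congr rfl fun b _ => ?_
          simp [MulChar.star_apply']
      _ = ∑ u : Rˣ, χ (u - v) * (χ⁻¹) u := MulChar.sum_eq_sum_units χ⁻¹ fun c => χ (c - v)
      _ = ∑ u : Rˣ, χ (1 - (v * u⁻¹ : Rˣ)) := by
          refine Finset.sum_congr rfl fun u _ => ?_
          rw [MulChar.inv_apply, Ring.inverse_unit, ← map_mul]
          congr 1
          push_cast
          rw [sub_mul, Units.mul_inv]
      _ = ∑ u : Rˣ, χ (1 - u) :=
          Equiv.sum_comp ((Equiv.inv Rˣ).trans (Equiv.mulLeft v)) fun u : Rˣ => χ (1 - u)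
  -- The complete sum vanishes, so the sum over units is bounded by the number of omitted non-units.
  have h2 : ∑ a, χ (1 - a) = 0 := by
    rw [← MulChar.sum_eq_zero_of_ne_one hχ]
    exact Equiv.sum_comp (Equiv.subLeft (1 : R)) fun a => χ a
  have h3 := norm_sum_sub_sum_units_le (fun a : R => χ (1 - a)) (M := 1) fun a =>
    χ.norm_apply_le_one _
  rwa [h2, zero_sub, norm_neg, mul_one, ← h1] at h3

/-- Mean square of a sum of translates of a nontrivial multiplicative character. -/
theorem MulChar.sum_norm_sq_sum_translate_le {R : Type*} [CommRing R] [Fintype R]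
    {χ : MulChar R ℂ} (hχ : χ ≠ 1) (H : ℕ) (v : ℕ → R)
    (hv : ∀ h < H, ∀ h' < H, h ≠ h' → IsUnit (v h - v h')) :
    ∑ b, ‖∑ h ∈ Finset.range H, χ (b + v h)‖ ^ 2 ≤
      H * Fintype.card R + (H : ℝ) ^ 2 * nonunitCount R := by
  have h1 : ((∑ b, ‖∑ h ∈ Finset.range H, χ (b + v h)‖ ^ 2 : ℝ) : ℂ) =
      ∑ h ∈ Finset.range H, ∑ h' ∈ Finset.range H, ∑ b, χ (b + v h) * star (χ (b + v h')) := by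
    push_cast
    rw [Finset.sum_congr rfl fun h _ => Finset.sum_comm, Finset.sum_comm]
    refine Finset.sum_congr rfl fun b _ => ?_
    rw [← Complex.mul_conj', map_sum, Finset.sum_mul_sum]
    rfl
  have h2 : ∀ h ∈ Finset.range H, ∀ h' ∈ Finset.range H,
      ‖∑ b, χ (b + v h) * star (χ (b + v h'))‖ ≤
        (if h = h' then (Fintype.card R : ℝ) else 0) + nonunitCount R := by
    intro h hh h' hh'
    rw [Finset.mem_range] at hh hh'
    split_ifs with he
    · refine (norm_sum_le_of_le (n := fun _ => (1 : ℝ)) _ fun b _ => ?_).trans ?_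
      · rw [norm_mul, norm_star]
        exact mul_le_one₀ (χ.norm_apply_le_one _) (norm_nonneg _) (χ.norm_apply_le_one _)
      · simp
    · rw [zero_add]
      have h3 := MulChar.norm_sum_mul_star_translate_le hχ (hv h' hh' h hh (Ne.symm he))
      refine le_of_eq_of_le (congrArg _ ?_) h3
      rw [← Equiv.sum_comp (Equiv.addRight (v h))
        fun c => χ c * star (χ (c + (v h' - v h)))]
      refine Finset.sum_congr rfl fun b _ => ?_
      simp only [Equiv.coe_addRight]
      congr 3
      ring
  calc ∑ b, ‖∑ h ∈ Finset.range H, χ (b + v h)‖ ^ 2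
      = ‖((∑ b, ‖∑ h ∈ Finset.range H, χ (b + v h)‖ ^ 2 : ℝ) : ℂ)‖ := by
        rw [Complex.norm_real, Real.norm_of_nonneg (by positivity)]
    _ ≤ ∑ h ∈ Finset.range H, ∑ h' ∈ Finset.range H,
          ((if h = h' then (Fintype.card R : ℝ) else 0) + nonunitCount R) := by
        rw [h1]
        exact norm_sum_le_of_le _ fun h hh => norm_sum_le_of_le _ fun h' hh' => h2 h hh h' hh'
    _ = H * Fintype.card R + (H : ℝ) ^ 2 * nonunitCount R := by
        have : ∀ h ∈ Finset.range H, ∑ h' ∈ Finset.range H,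
            ((if h = h' then (Fintype.card R : ℝ) else 0) + nonunitCount R) =
              Fintype.card R + H * nonunitCount R := by
          intro h hh
          rw [Finset.sum_add_distrib, Finset.sum_ite_eq, if_pos hh]
          simp
        rw [Finset.sum_congr rfl this]
        simp
        ring

/-- Sums along `n`-th powers of units, expanded in Dirichlet characters of order dividing `n`. -/
theorem sum_units_comp_pow_eq {m : ℕ} [NeZero m] (n : ℕ) (A : ZMod m → ℂ) :
    ∑ u : (ZMod m)ˣ, A ((u : ZMod m) ^ n) =
      ∑ χ : DirichletCharacter ℂ m with χ ^ n = 1, ∑ b, A b * χ b := by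
  have hφ : (m.totient : ℂ) ≠ 0 := by exact_mod_cast (Nat.totient_pos.2 (NeZero.pos m)).ne'
  -- Orthogonality of characters detects `u ^ n = b`; summing over `u` then kills every `χ` with `χ
  -- ^ n ≠ 1`.
  have h1 : ∀ u : (ZMod m)ˣ, (m.totient : ℂ) * A ((u : ZMod m) ^ n) =
      ∑ χ : DirichletCharacter ℂ m, (χ ^ n) ((u⁻¹ : (ZMod m)ˣ) : ZMod m) * ∑ b, A b * χ b := by
    intro u
    have h2 : ∀ b : ZMod m, A b * (if (u : ZMod m) ^ n = b then (m.totient : ℂ) else 0) =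
        ∑ χ : DirichletCharacter ℂ m, (χ ^ n) ((u⁻¹ : (ZMod m)ˣ) : ZMod m) * (A b * χ b) := by
      intro b
      rw [← DirichletCharacter.sum_char_inv_mul_char_eq ℂ (u.isUnit.pow n) b, Finset.mul_sum]
      refine Finset.sum_congr rfl fun χ _ => ?_
      rw [← Units.val_pow_eq_pow_val, ZMod.inv_coe_unit, ← inv_pow, Units.val_pow_eq_pow_val,
        map_pow, MulChar.pow_apply_coe]
      ring
    simp only [Finset.mul_sum]
    rw [Finset.sum_comm, ← Finset.sum_congr rfl fun b _ => h2 b]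
    simp [mul_comm]
  refine mul_left_cancel₀ hφ ?_
  rw [Finset.mul_sum, Finset.sum_congr rfl fun u _ => h1 u, Finset.sum_comm, Finset.mul_sum,
    Finset.sum_filter]
  refine Finset.sum_congr rfl fun χ _ => ?_
  rw [← Finset.sum_mul]
  have h3 : ∑ u : (ZMod m)ˣ, (χ ^ n) ((u⁻¹ : (ZMod m)ˣ) : ZMod m) = ∑ a, (χ ^ n) a := by
    refine (Equiv.sum_comp (Equiv.inv (ZMod m)ˣ)
      fun u : (ZMod m)ˣ => (χ ^ n) (u : ZMod m)).trans ?_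
    simpa using (MulChar.sum_eq_sum_units (χ ^ n) fun _ => 1).symm
  rw [h3]
  split_ifs with h
  · rw [h, MulChar.sum_one_eq_card_units, ZMod.card_units_eq_totient]
  · rw [MulChar.sum_eq_zero_of_ne_one h, zero_mul]

theorem MulEquiv.card_pow_eq_one {G K : Type*} [Group G] [Group K] (e : G ≃* K) (n : ℕ) :
    Nat.card {g : G // g ^ n = 1} = Nat.card {g : K // g ^ n = 1} :=
  Nat.card_congr (e.toEquiv.subtypeEquiv fun g => by
    simp only [MulEquiv.toEquiv_eq_coe, EquivLike.coe_coe, ← map_pow, map_eq_one_iff e e.injective])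

theorem Prod.card_pow_eq_one {G K : Type*} [Group G] [Group K] (n : ℕ) :
    Nat.card {g : G × K // g ^ n = 1} =
      Nat.card {g : G // g ^ n = 1} * Nat.card {g : K // g ^ n = 1} := by
  rw [← Nat.card_prod]
  refine Nat.card_congr (Equiv.trans (Equiv.subtypeEquivRight fun g => ?_)
    Equiv.subtypeProdEquivProd)
  rw [Prod.ext_iff]
  rfl

/-- An odd modulus has at most `n ^ ω(m)` roots of unity of order dividing `n`. -/
theorem ZMod.card_units_pow_eq_one_le {m : ℕ} (hm : Odd m) {n : ℕ} (hn : 0 < n) :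
    Nat.card {u : (ZMod m)ˣ // u ^ n = 1} ≤ n ^ m.primeFactors.card := by
  induction m using Nat.recOnPrimeCoprime with
  | zero => simp at hm
  | prime_pow p a hp =>
    rcases Nat.eq_zero_or_pos a with rfl | ha
    · simp only [pow_zero]
      rw [Nat.primeFactors_one, Finset.card_empty, pow_zero]
      exact Finite.card_le_one_iff_subsingleton.2 inferInstance
    have hp2 : p ≠ 2 := by
      rintro rfl
      exact (Nat.not_odd_iff_even.2 (even_two.pow_of_ne_zero ha.ne')) hm
    have := ZMod.isCyclic_units_of_prime_pow p hp hp2 a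
    have : NeZero (p ^ a) := ⟨(pow_pos hp.pos a).ne'⟩
    classical
    rw [Nat.primeFactors_prime_pow ha.ne' hp, Finset.card_singleton, pow_one,
      Nat.card_eq_fintype_card, Fintype.card_subtype]
    exact IsCyclic.card_pow_eq_one_le hn
  | coprime a b ha hb hab iha ihb =>
    rw [Nat.odd_mul] at hm
    rw [hab.primeFactors_mul, Finset.card_union_of_disjoint hab.disjoint_primeFactors, pow_add,
      MulEquiv.card_pow_eq_one ((Units.mapEquiv (ZMod.chineseRemainder hab).toMulEquiv).trans
        MulEquiv.prodUnits), Prod.card_pow_eq_one]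
    exact Nat.mul_le_mul (iha hm.1) (ihb hm.2)

/-- The character group is isomorphic to the unit group, so the count of roots of unity transfers.
-/
theorem DirichletCharacter.card_pow_eq_one_le {m : ℕ} [NeZero m] (hm : _root_.Odd m) {n : ℕ}
    (hn : 0 < n) :
    (Finset.univ.filter fun χ : DirichletCharacter ℂ m => χ ^ n = 1).card ≤
      n ^ m.primeFactors.card := by
  obtain ⟨e⟩ := DirichletCharacter.mulEquiv_units ℂ m
  rw [← Fintype.card_subtype, ← Nat.card_eq_fintype_card, e.card_pow_eq_one]
  exact ZMod.card_units_pow_eq_one_le hm hn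

/-- A modulus with few prime factors, all large, has few non-units. -/
theorem ZMod.nonunitCount_le {m : ℕ} [NeZero m] {P k : ℕ} (hP : 0 < P)
    (hm : ∀ p ∈ m.primeFactors, P ≤ p) (hk : m.primeFactors.card ≤ k) :
    (nonunitCount (ZMod m) : ℝ) ≤ k / P * m := by
  have : DecidablePred fun a : ZMod m => IsUnit a := Classical.decPred _
  have hsub : (Finset.univ.filter fun a : ZMod m => ¬ IsUnit a) ⊆
      m.primeFactors.biUnion fun p => Finset.univ.filter fun a : ZMod m => p ∣ a.val := by
    intro a ha
    simp only [Finset.mem_filter, Finset.mem_univ, true_and, Finset.mem_biUnion] at ha ⊢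
    rw [← ZMod.natCast_zmod_val a, ZMod.isUnit_iff_coprime, Nat.Prime.not_coprime_iff_dvd] at ha
    obtain ⟨p, hp, hpa, hpm⟩ := ha
    exact ⟨p, Nat.mem_primeFactors.2 ⟨hp, hpm, NeZero.ne m⟩, hpa⟩
  have hP' : (0 : ℝ) < P := by exact_mod_cast hP
  calc (nonunitCount (ZMod m) : ℝ)
      ≤ ∑ p ∈ m.primeFactors,
          ((Finset.univ.filter fun a : ZMod m => p ∣ a.val).card : ℝ) := by
        rw [nonunitCount_eq_card_filter]
        exact_mod_cast (Finset.card_le_card hsub).trans Finset.card_biUnion_le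
    _ ≤ ∑ p ∈ m.primeFactors, m * (P : ℝ)⁻¹ := by
        refine Finset.sum_le_sum fun p hp =>
          (card_filter_dvd_val_le (Nat.dvd_of_mem_primeFactors hp)).trans ?_
        gcongr
        exact hm p hp
    _ = m.primeFactors.card * (m * (P : ℝ)⁻¹) := by simp
    _ ≤ k * (m * (P : ℝ)⁻¹) := by gcongr
    _ = k / P * m := by ring

/-- Near invariance of `A` allows `χ` to be replaced by the average of its `H` translates, at cost
`η`. Near orthogonality makes the mean square of that average at most `1 / H + κ`, and
Cauchy–Schwarz gives the square root. -/
theorem norm_sum_mul_mulChar_le {R : Type*} [CommRing R] [Fintype R] {χ : MulChar R ℂ}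
    (hχ : χ ≠ 1) {H : ℕ} (hH : 0 < H) {v : ℕ → R}
    (hv : ∀ h < H, ∀ h' < H, h ≠ h' → IsUnit (v h - v h')) {A : R → ℂ} {M η κ : ℝ}
    (hM : ∀ a, ‖A a‖ ≤ M) (hη : ∀ h < H, ∀ b, ‖A (b + v h) - A b‖ ≤ η)
    (hκ : (nonunitCount R : ℝ) ≤ κ * Fintype.card R) :
    ‖∑ b, A b * χ b‖ ≤ (η + M * √(1 / H + κ)) * Fintype.card R := by
  have hH' : (0 : ℝ) < H := by exact_mod_cast hH
  have hM0 : 0 ≤ M := (norm_nonneg _).trans (hM 0)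
  have hη0 : 0 ≤ η := (norm_nonneg _).trans (hη 0 hH 0)
  have hR : (0 : ℝ) < Fintype.card R := by exact_mod_cast Fintype.card_pos
  have hκ0 : 0 ≤ κ := by
    by_contra! h
    have h1 : (0 : ℝ) ≤ nonunitCount R := by positivity
    nlinarith [mul_neg_of_neg_of_pos h hR]
  have h1 : (H : ℂ) * ∑ b, A b * χ b =
      ∑ h ∈ Finset.range H, ∑ b, (A (b + v h) - A b) * χ (b + v h) +
        ∑ b, A b * ∑ h ∈ Finset.range H, χ (b + v h) := by
    have h2 : ∀ h ∈ Finset.range H, ∑ b, A b * χ b =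
        ∑ b, (A (b + v h) - A b) * χ (b + v h) + ∑ b, A b * χ (b + v h) := by
      intro h _
      rw [← Finset.sum_add_distrib, ← Equiv.sum_comp (Equiv.addRight (v h)) fun b => A b * χ b]
      refine Finset.sum_congr rfl fun b _ => ?_
      simp only [Equiv.coe_addRight]
      ring
    simp only [Finset.mul_sum (Finset.range H)]
    rw [Finset.sum_comm (s := Finset.univ), ← Finset.sum_add_distrib, ← Finset.sum_congr rfl h2]
    simp
  have h3 : ‖∑ h ∈ Finset.range H, ∑ b, (A (b + v h) - A b) * χ (b + v h)‖ ≤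
      H * (Fintype.card R * η) := by
    refine (norm_sum_le_of_le (n := fun _ => Fintype.card R * η) _ fun h hh => ?_).trans ?_
    · refine (norm_sum_le_of_le (n := fun _ => η) _ fun b _ => ?_).trans ?_
      · rw [norm_mul]
        exact (mul_le_of_le_one_right (norm_nonneg _) (χ.norm_apply_le_one _)).trans
          (hη h (Finset.mem_range.1 hh) b)
      · simp
    · simp
  have h4 : ∑ b, ‖∑ h ∈ Finset.range H, χ (b + v h)‖ ≤
      H * Fintype.card R * √(1 / H + κ) := by
    refine abs_le_of_sq_le_sq' ?_ (by positivity) |>.2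
    have h5 := sq_sum_le_card_mul_sum_sq (s := (Finset.univ : Finset R))
      (f := fun b => ‖∑ h ∈ Finset.range H, χ (b + v h)‖)
    refine h5.trans ?_
    rw [Finset.card_univ, mul_pow, Real.sq_sqrt (by positivity)]
    have h6 := MulChar.sum_norm_sq_sum_translate_le hχ H v hv
    have h7 : (H : ℝ) ^ 2 * nonunitCount R ≤ (H : ℝ) ^ 2 * (κ * Fintype.card R) := by gcongr
    calc (Fintype.card R : ℝ) * ∑ b, ‖∑ h ∈ Finset.range H, χ (b + v h)‖ ^ 2
        ≤ Fintype.card R * (H * Fintype.card R + (H : ℝ) ^ 2 * (κ * Fintype.card R)) := by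
          gcongr; linarith
      _ = _ := by field_simp
  have h8 : ‖∑ b, A b * ∑ h ∈ Finset.range H, χ (b + v h)‖ ≤
      M * (H * Fintype.card R * √(1 / H + κ)) := by
    calc _ ≤ ∑ b, M * ‖∑ h ∈ Finset.range H, χ (b + v h)‖ :=
          norm_sum_le_of_le _ fun b _ => by rw [norm_mul]; gcongr; exact hM b
      _ = M * ∑ b, ‖∑ h ∈ Finset.range H, χ (b + v h)‖ := by rw [Finset.mul_sum]
      _ ≤ _ := by gcongr
  have h9 : (H : ℝ) * ‖∑ b, A b * χ b‖ ≤
      H * (Fintype.card R * η) + M * (H * Fintype.card R * √(1 / H + κ)) := by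
    rw [← Complex.norm_natCast, ← norm_mul, h1, Complex.norm_natCast]
    exact (norm_add_le _ _).trans (add_le_add h3 h8)
  refine le_of_mul_le_mul_left (h9.trans_eq ?_) hH'
  ring

/-- A function on `ZMod m` that is almost invariant under many translations and has small mean
has a small average along `n`-th powers, when `m` has few non-units. -/
theorem norm_sum_comp_pow_le_of_almost_invariant {m : ℕ} [NeZero m] {n H : ℕ} (hH : 0 < H)
    {v : ℕ → ZMod m} (hv : ∀ h < H, ∀ h' < H, h ≠ h' → IsUnit (v h - v h')) {A : ZMod m → ℂ}
    {M η δ κ K : ℝ} (hM : ∀ a, ‖A a‖ ≤ M) (hη : ∀ h < H, ∀ b, ‖A (b + v h) - A b‖ ≤ η)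
    (hδ : ‖∑ b, A b‖ ≤ δ * m) (hκ : (nonunitCount (ZMod m) : ℝ) ≤ κ * m)
    (hK : ((Finset.univ.filter fun χ : DirichletCharacter ℂ m => χ ^ n = 1).card : ℝ) ≤ K) :
    ‖∑ j, A (j ^ n)‖ ≤ (2 * (κ * M) + δ + K * (η + M * √(1 / H + κ))) * m := by
  have hM0 : 0 ≤ M := (norm_nonneg _).trans (hM 0)
  have hη0 : 0 ≤ η := (norm_nonneg _).trans (hη 0 hH 0)
  have hδ0 : 0 ≤ δ * m := (norm_nonneg _).trans hδ
  have hκM : nonunitCount (ZMod m) * M ≤ κ * m * M := by gcongr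
  have h1 : ‖∑ j, A (j ^ n) - ∑ u : (ZMod m)ˣ, A ((u : ZMod m) ^ n)‖ ≤ κ * m * M :=
    (norm_sum_sub_sum_units_le (fun j => A (j ^ n)) fun a => hM _).trans hκM
  have hX0 : (0 : ℝ) ≤ (η + M * √(1 / H + κ)) * m := by positivity
  have h2 : ∀ χ : DirichletCharacter ℂ m, ‖∑ b, A b * χ b‖ ≤
      (if χ = 1 then κ * m * M + δ * m else 0) + (η + M * √(1 / H + κ)) * m := by
    intro χ
    split_ifs with hχ
    · have h3 : ∑ b, A b * χ b = ∑ u : (ZMod m)ˣ, A u := by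
        rw [MulChar.sum_eq_sum_units, hχ]
        simp
      have h4 := (norm_sum_sub_sum_units_le A hM).trans hκM
      rw [h3]
      have h5 := norm_sub_norm_le (∑ u : (ZMod m)ˣ, A u) (∑ b, A b)
      rw [norm_sub_rev] at h5
      linarith
    · rw [zero_add]
      have := norm_sum_mul_mulChar_le hχ hH hv hM hη (by rwa [ZMod.card])
      rwa [ZMod.card] at this
  have h6 : ‖∑ u : (ZMod m)ˣ, A ((u : ZMod m) ^ n)‖ ≤
      κ * m * M + δ * m + K * ((η + M * √(1 / H + κ)) * m) := by
    rw [sum_units_comp_pow_eq]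
    refine (norm_sum_le_of_le _ fun χ _ => h2 χ).trans ?_
    rw [Finset.sum_add_distrib, Finset.sum_const, nsmul_eq_mul, Finset.sum_ite_eq']
    refine add_le_add ?_ (by gcongr)
    have : 0 ≤ κ * m * M := (by positivity : (0 : ℝ) ≤ nonunitCount (ZMod m) * M).trans hκM
    split_ifs
    · exact le_rfl
    · positivity
  have h7 := norm_add_le (∑ j, A (j ^ n) - ∑ u : (ZMod m)ˣ, A ((u : ZMod m) ^ n))
    (∑ u : (ZMod m)ˣ, A ((u : ZMod m) ^ n))
  rw [sub_add_cancel] at h7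
  refine (h7.trans (add_le_add h1 h6)).trans_eq ?_
  ring

/-! ### Combining the two moduli. -/

theorem isUnit_natCast_sub_of_ne {m H c : ℕ}
    (hu : ∀ h, 0 < h → h < H → IsUnit ((h * c : ℕ) : ZMod m)) {h h' : ℕ} (hh : h < H)
    (hh' : h' < H) (hne : h ≠ h') :
    IsUnit (((h * c : ℕ) : ZMod m) - ((h' * c : ℕ) : ZMod m)) := by
  wlog hlt : h' < h generalizing h h'
  · rw [← neg_sub, IsUnit.neg_iff]
    exact this hh' hh hne.symm (by omega)
  have h1 := hu (h - h') (by omega) (by omega)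
  have h2 : h * c = (h - h') * c + h' * c := by
    rw [← Nat.add_mul, Nat.sub_add_cancel hlt.le]
  rw [h2, Nat.cast_add, add_sub_cancel_right]
  exact h1

/-- Averages over a coset in the first factor and along `n`-th powers in the second factor of
`ZMod s × ZMod m`. -/
theorem norm_sum_coset_pow_le {s m : ℕ} [NeZero s] [NeZero m] {n H Q D : ℕ} (hH : 0 < H)
    (hD : IsUnit (D : ZMod m))
    (hu : ∀ h, 0 < h → h < H → IsUnit ((h * (Q * D) : ℕ) : ZMod m))
    {G : ZMod s × ZMod m → ℂ} {M η δ κ K : ℝ} (hM : ∀ a, ‖G a‖ ≤ M)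
    (hη : ∀ h < H, ∀ a, ‖G (a + ((h * (Q * D) : ℕ) : ZMod s × ZMod m)) - G a‖ ≤ η)
    (hδ : ∀ r, ‖∑ z, G (r + (D : ZMod s × ZMod m) * z)‖ ≤ δ * (s * m))
    (hκ : (nonunitCount (ZMod m) : ℝ) ≤ κ * m)
    (hK : ((Finset.univ.filter fun χ : DirichletCharacter ℂ m => χ ^ n = 1).card : ℝ) ≤ K)
    (r : ZMod s) :
    ‖∑ y : ZMod s, ∑ j : ZMod m, G (r + D * y, j ^ n)‖ ≤
      (2 * (κ * M) + δ + K * (η + M * √(1 / H + κ))) * (s * m) := by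
  rw [Finset.sum_comm]
  have hA := norm_sum_comp_pow_le_of_almost_invariant (n := n) hH
    (v := fun h => ((h * (Q * D) : ℕ) : ZMod m))
    (fun h hh h' hh' hne => isUnit_natCast_sub_of_ne hu hh hh' hne)
    (A := fun b => ∑ y : ZMod s, G (r + D * y, b)) (M := s * M) (η := s * η) (δ := s * δ)
    (κ := κ) (K := K) ?_ ?_ ?_ hκ hK
  · refine hA.trans_eq ?_
    ring
  · intro a
    refine (norm_sum_le_of_le _ fun y _ => hM _).trans ?_
    simp [ZMod.card]
  · intro h hh b
    have h1 : ∑ y : ZMod s, G (r + D * y, b + ((h * (Q * D) : ℕ) : ZMod m)) =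
        ∑ y : ZMod s, G ((r + D * y, b) + ((h * (Q * D) : ℕ) : ZMod s × ZMod m)) := by
      -- Shifting `y` by `h * Q` moves the first coordinate by `h * (Q * D)`: after summing over the
      -- coset, diagonal near invariance becomes near invariance in the second factor alone.
      rw [← Equiv.sum_comp (Equiv.addRight ((h * Q : ℕ) : ZMod s))
        fun y : ZMod s => G (r + D * y, b + ((h * (Q * D) : ℕ) : ZMod m))]
      refine Finset.sum_congr rfl fun y _ => congrArg G (Prod.ext ?_ ?_)
      · simp
        ring
      · simp
    simp only [h1]
    rw [← Finset.sum_sub_distrib]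
    refine (norm_sum_le_of_le _ fun y _ => hη h hh _).trans ?_
    simp [ZMod.card]
  · have h2 : ∑ b : ZMod m, ∑ y : ZMod s, G (r + D * y, b) =
        ∑ z, G ((r, 0) + (D : ZMod s × ZMod m) * z) := by
      rw [Fintype.sum_prod_type, Finset.sum_comm]
      refine Finset.sum_congr rfl fun y _ => ?_
      rw [← Equiv.sum_comp (Units.mulLeft hD.unit)]
      refine Finset.sum_congr rfl fun b _ => congrArg G (Prod.ext ?_ ?_) <;> simp
    rw [h2]
    refine (hδ _).trans_eq ?_
    ring

theorem isUnit_natCast_of_lt_primeFactors {m a : ℕ} [NeZero m] (ha : 0 < a)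
    (h : ∀ p ∈ m.primeFactors, a < p) : IsUnit (a : ZMod m) := by
  rw [ZMod.isUnit_iff_coprime]
  by_contra hc
  obtain ⟨p, hp, hpa, hpm⟩ := Nat.Prime.not_coprime_iff_dvd.1 hc
  have := h p (Nat.mem_primeFactors.2 ⟨hp, hpm, NeZero.ne m⟩)
  exact absurd (Nat.le_of_dvd ha hpa) (by omega)

theorem exists_nat_error_le (M K : ℝ) {ε : ℝ} (hε : 0 < ε) :
    ∃ H : ℕ, 0 < H ∧ 2 * (1 / (H : ℝ) * M) + K * (M * √(1 / H + 1 / H)) ≤ ε := by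
  have h0 : Tendsto (fun H : ℕ => 1 / (H : ℝ)) atTop (𝓝 0) :=
    tendsto_one_div_atTop_nhds_zero_nat
  have h1 : Tendsto (fun H : ℕ => 2 * (1 / (H : ℝ) * M) + K * (M * √(1 / H + 1 / H))) atTop
      (𝓝 (2 * (0 * M) + K * (M * √(0 + 0)))) :=
    ((h0.mul_const M).const_mul 2).add
      ((((Real.continuous_sqrt.tendsto _).comp (h0.add h0)).const_mul M).const_mul K)
  simp only [zero_mul, mul_zero, add_zero, Real.sqrt_zero] at h1
  obtain ⟨H, hH1, hH2⟩ := ((h1.eventually_le_const hε).and (eventually_gt_atTop 0)).exists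
  exact ⟨H, hH2, hH1⟩

/-- Equidistribution along `n`-th powers on `ZMod s × ZMod m`, where `s` is supported on a fixed
set of primes and `m` has few prime factors, all large. -/
theorem exists_params_norm_sum_pow_le (S : Finset ℕ) (hS : ∀ p ∈ S, p ≠ 0) {n : ℕ} (hn : n ≠ 0)
    (k : ℕ) {M : ℝ} (hM0 : 0 ≤ M) {ε : ℝ} (hε : 0 < ε) :
    ∃ Dmax H P : ℕ, ∃ η : ℝ, 0 < H ∧ 0 < η ∧
      ∀ (s m : ℕ) [NeZero s] [NeZero m], s.primeFactors ⊆ S → m.primeFactors.card ≤ k →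
      ∀ Q : ℕ, 0 < Q → (∀ p ∈ m.primeFactors, P ≤ p ∧ H * (Q * Dmax) < p) →
      ∀ G : ZMod s × ZMod m → ℂ, (∀ a, ‖G a‖ ≤ M) →
      (∀ D : ℕ, 0 < D → D ≤ Dmax →
        (∀ h < H, ∀ a, ‖G (a + ((h * (Q * D) : ℕ) : ZMod s × ZMod m)) - G a‖ ≤ η) ∧
        (∀ r, ‖∑ z, G (r + (D : ZMod s × ZMod m) * z)‖ ≤ η * (s * m))) →
      ‖∑ a, G (a ^ n)‖ ≤ ε * (s * m) := by
  obtain ⟨Dmax, hDmax⟩ := exists_norm_sum_comp_pow_le S hS n hn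
    (ε := ε / (2 * (M + 1))) (by positivity)
  obtain ⟨H, hH, hHε⟩ := exists_nat_error_le M (n ^ k : ℕ) (ε := ε / 4) (by positivity)
  have hH' : (0 : ℝ) < H := by exact_mod_cast hH
  set K : ℝ := ((n ^ k : ℕ) : ℝ) with hK
  have hK0 : 0 ≤ K := by positivity
  -- Primes at least `k * H + 3` force `m` to be odd and the proportion of non-units to be at most
  -- `1 / H`; `η` is chosen so that `(1 + K) * η = ε / 4`.
  refine ⟨Dmax, H, k * H + 3, ε / (4 * (1 + K)), hH, by positivity,
    fun s m _ _ hs hmk Q hQ hmP G hGM hG => ?_⟩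
  have hs0 : (0 : ℝ) < s := by exact_mod_cast NeZero.pos s
  have hm0 : (0 : ℝ) < m := by exact_mod_cast NeZero.pos m
  have hodd : Odd m := by
    by_contra hev
    rw [Nat.not_odd_iff_even] at hev
    have := (hmP 2 (Nat.mem_primeFactors.2 ⟨Nat.prime_two, hev.two_dvd, NeZero.ne m⟩)).1
    omega
  have hchar : ((Finset.univ.filter fun χ : DirichletCharacter ℂ m => χ ^ n = 1).card : ℝ) ≤
      K := by
    rw [hK]
    exact_mod_cast (DirichletCharacter.card_pow_eq_one_le hodd (Nat.pos_of_ne_zero hn)).trans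
      (Nat.pow_le_pow_right (Nat.pos_of_ne_zero hn) hmk)
  have hκ : (nonunitCount (ZMod m) : ℝ) ≤ 1 / H * m := by
    refine (ZMod.nonunitCount_le (P := k * H + 3) (by omega) (fun p hp => (hmP p hp).1)
      hmk).trans ?_
    refine mul_le_mul_of_nonneg_right ?_ hm0.le
    rw [div_le_div_iff₀ (by positivity) hH']
    push_cast
    linarith
  have h1 := hDmax s hs (fun c => ∑ j : ZMod m, G (c, j ^ n)) (m * M) (ε / 2 * m)
    (by positivity) ?_ ?_
  · rw [Fintype.sum_prod_type]
    refine h1.trans ?_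
    have h2 : ε / (2 * (M + 1)) * M ≤ ε / 2 := by
      rw [div_mul_eq_mul_div, div_le_div_iff₀ (by positivity) (by positivity)]
      nlinarith
    calc (ε / 2 * m + ε / (2 * (M + 1)) * (m * M)) * s
        = (ε / 2 + ε / (2 * (M + 1)) * M) * (s * m) := by ring
      _ ≤ (ε / 2 + ε / 2) * (s * m) := by gcongr
      _ = ε * (s * m) := by ring
  · intro a
    refine (norm_sum_le_of_le _ fun y _ => hGM _).trans ?_
    simp [ZMod.card]
  · intro D hDs hDle r
    have hDpos : 0 < D := Nat.pos_of_dvd_of_pos hDs (NeZero.pos s)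
    obtain ⟨hGη, hGδ⟩ := hG D hDpos hDle
    have hle : ∀ h, 0 < h → h ≤ H → IsUnit ((h * (Q * D) : ℕ) : ZMod m) := by
      intro h hh hhH
      refine isUnit_natCast_of_lt_primeFactors (by positivity) fun p hp => ?_
      refine lt_of_le_of_lt ?_ (hmP p hp).2
      gcongr
    have hDu : IsUnit (D : ZMod m) := by
      have := hle H hH le_rfl
      rw [← mul_assoc, Nat.cast_mul] at this
      exact isUnit_of_mul_isUnit_right this
    have h3 := norm_sum_coset_pow_le (n := n) hH hDu (fun h hh hhH => hle h hh hhH.le) hGM hGη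
      hGδ hκ hchar r
    refine h3.trans ?_
    have h4 : ε / (4 * (1 + K)) * (1 + K) = ε / 4 := by field_simp
    calc _ = (2 * (1 / (H : ℝ) * M) + K * (M * √(1 / H + 1 / H)) +
            ε / (4 * (1 + K)) * (1 + K)) * (s * m) := by ring
      _ ≤ (ε / 4 + ε / 4) * (s * m) := by rw [h4]; gcongr
      _ = ε / 2 * m * s := by ring

/-- The same as `exists_params_norm_sum_pow_le`, on `ZMod (s * m)`. -/
theorem exists_params_norm_sum_zmod_pow_le (S : Finset ℕ) (hS : ∀ p ∈ S, p ≠ 0) {n : ℕ}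
    (hn : n ≠ 0) (k : ℕ) {M : ℝ} (hM0 : 0 ≤ M) {ε : ℝ} (hε : 0 < ε) :
    ∃ Dmax H P : ℕ, ∃ η : ℝ, 0 < H ∧ 0 < η ∧
      ∀ (q s m : ℕ) [NeZero q], q = s * m → s.Coprime m → s.primeFactors ⊆ S →
      m.primeFactors.card ≤ k →
      ∀ Q : ℕ, 0 < Q → (∀ p ∈ m.primeFactors, P ≤ p ∧ H * (Q * Dmax) < p) →
      ∀ G : ZMod q → ℂ, (∀ a, ‖G a‖ ≤ M) →
      (∀ D : ℕ, 0 < D → D ≤ Dmax →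
        (∀ h < H, ∀ a, ‖G (a + ((h * (Q * D) : ℕ) : ZMod q)) - G a‖ ≤ η) ∧
        (∀ r, ‖∑ z, G (r + (D : ZMod q) * z)‖ ≤ η * q)) →
      ‖∑ a, G (a ^ n)‖ ≤ ε * q := by
  obtain ⟨Dmax, H, P, η, hH, hη, hmain⟩ := exists_params_norm_sum_pow_le S hS hn k hM0 hε
  refine ⟨Dmax, H, P, η, hH, hη, ?_⟩
  rintro q s m hq0 rfl hsm hs hmk Q hQ hmP G hGM hG
  have : NeZero s := ⟨fun h => hq0.out (by rw [h, zero_mul])⟩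
  have : NeZero m := ⟨fun h => hq0.out (by rw [h, mul_zero])⟩
  let e := ZMod.chineseRemainder hsm
  have h1 := hmain s m hs hmk Q hQ hmP (fun a => G (e.symm a)) (fun a => hGM _) ?_
  · rw [← Equiv.sum_comp e.toEquiv] at h1
    push_cast
    simpa [← map_pow] using h1
  · intro D hD hDle
    obtain ⟨h2, h3⟩ := hG D hD hDle
    refine ⟨fun h hh a => ?_, fun r => ?_⟩
    · rw [map_add, map_natCast]
      exact h2 h hh _
    · rw [← Equiv.sum_comp e.toEquiv]
      have h4 := h3 (e.symm r)
      push_cast at h4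
      simpa [map_add, map_mul] using h4

/-! ### Separating bounded primes from escaping ones. -/

theorem Nat.exists_eq_mul_primeFactors_subset (S : Finset ℕ) {q : ℕ} (hq : q ≠ 0) :
    ∃ s m : ℕ, q = s * m ∧ s.Coprime m ∧ s.primeFactors ⊆ S ∧ ∀ p ∈ m.primeFactors, p ∉ S := by
  suffices h : ∃ s m : ℕ, q = s * m ∧ s.primeFactors ⊆ S ∧ ∀ p ∈ m.primeFactors, p ∉ S by
    obtain ⟨s, m, rfl, hs, hm⟩ := h
    refine ⟨s, m, rfl, ?_, hs, hm⟩
    rw [← Nat.disjoint_primeFactors (left_ne_zero_of_mul hq) (right_ne_zero_of_mul hq)]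
    exact Finset.disjoint_left.2 fun p hp hp' => hm p hp' (hs hp)
  induction q using Nat.recOnPrimeCoprime with
  | zero => exact absurd rfl hq
  | prime_pow p a hp =>
    have hpa : ∀ p' ∈ (p ^ a).primeFactors, p' = p := fun p' hp' =>
      (Nat.prime_dvd_prime_iff_eq (Nat.prime_of_mem_primeFactors hp') hp).1
        ((Nat.prime_of_mem_primeFactors hp').dvd_of_dvd_pow (Nat.dvd_of_mem_primeFactors hp'))
    by_cases hpS : p ∈ S
    · exact ⟨p ^ a, 1, by simp, fun p' hp' => (hpa p' hp').symm ▸ hpS, by simp⟩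
    · exact ⟨1, p ^ a, by simp, by simp, fun p' hp' => (hpa p' hp').symm ▸ hpS⟩
  | coprime a b ha hb hab iha ihb =>
    obtain ⟨s, m, rfl, hs, hm⟩ := iha (by omega)
    obtain ⟨s', m', rfl, hs', hm'⟩ := ihb (by omega)
    have h1 : s * m ≠ 0 := by omega
    have h2 : s' * m' ≠ 0 := by omega
    refine ⟨s * s', m * m', by ring, ?_, ?_⟩
    · rw [Nat.primeFactors_mul (left_ne_zero_of_mul h1) (left_ne_zero_of_mul h2)]
      exact Finset.union_subset hs hs'
    · rw [Nat.primeFactors_mul (right_ne_zero_of_mul h1) (right_ne_zero_of_mul h2)]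
      intro p hp
      exact (Finset.mem_union.1 hp).elim (hm p) (hm' p)

/-- A sequence of finite sets of natural numbers of bounded size has a subsequence along which
all elements outside a fixed finite set tend to infinity. -/
theorem exists_subseq_finset_escape (k : ℕ) (A : ℕ → Finset ℕ) (hA : ∀ n, (A n).card ≤ k) :
    ∃ (φ : ℕ → ℕ) (S : Finset ℕ), StrictMono φ ∧ (∀ p ∈ S, ∃ n, p ∈ A n) ∧
      ∀ P : ℕ, ∀ᶠ n in atTop, ∀ p ∈ A (φ n), p ∉ S → P ≤ p := by
  induction k generalizing A with
  | zero =>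
    refine ⟨id, ∅, strictMono_id, by simp, fun P => Eventually.of_forall fun n p hp => ?_⟩
    have := Finset.card_eq_zero.1 (Nat.le_zero.1 (hA n))
    simp [this] at hp
  | succ k ih =>
    by_cases h : ∀ P : ℕ, ∀ᶠ n in atTop, ∀ p ∈ A n, P ≤ p
    · exact ⟨id, ∅, strictMono_id, by simp, fun P => (h P).mono fun n hn p hp _ => hn p hp⟩
    · push Not at h
      obtain ⟨P, hP⟩ := h
      -- By pigeonhole some `p < P` recurs; pass to the sets containing it, erase it, and induct.
      have hp : ∃ p, ∃ᶠ n in atTop, p ∈ A n := by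
        by_contra! hcon
        have hev : ∀ᶠ n in atTop, ∀ p ∈ Finset.range P, p ∉ A n :=
          (Finset.eventually_all _).2 fun p _ => hcon p
        obtain ⟨n, ⟨p, hpA, hpP⟩, hn⟩ := (hP.and_eventually hev).exists
        exact hn p (Finset.mem_range.2 hpP) hpA
      obtain ⟨p, hp⟩ := hp
      obtain ⟨φ, hφ, hφp⟩ := extraction_of_frequently_atTop hp
      obtain ⟨ψ, S, hψ, hS, hlim⟩ := ih (fun n => (A (φ n)).erase p) fun n => by
        rw [Finset.card_erase_of_mem (hφp n)]
        have := hA (φ n)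
        omega
      refine ⟨φ ∘ ψ, insert p S, hφ.comp hψ, ?_, fun P' => (hlim P').mono fun n hn p' hp' hpS => ?_⟩
      · intro p' hp'
        rcases Finset.mem_insert.1 hp' with rfl | hp'
        · exact ⟨φ 0, hφp 0⟩
        · obtain ⟨n, hn⟩ := hS p' hp'
          exact ⟨φ n, Finset.mem_of_mem_erase hn⟩
      · rw [Finset.mem_insert, not_or] at hpS
        exact hn p' (Finset.mem_erase.2 ⟨hpS.1, hp'⟩) hpS.2

/-! ### Transfer to orbits through rigidity. -/

theorem ZMod.sum_eq_sum_range {q : ℕ} [NeZero q] (g : ZMod q → ℂ) :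
    ∑ a, g a = ∑ i ∈ Finset.range q, g i := by
  refine Finset.sum_nbij' (fun a => a.val) (fun i => (i : ZMod q)) ?_ ?_ ?_ ?_ ?_
  · intro a _
    exact Finset.mem_range.2 (ZMod.val_lt a)
  · intro i _
    exact Finset.mem_univ _
  · intro a _
    exact ZMod.natCast_zmod_val a
  · intro i hi
    exact ZMod.val_cast_of_lt (Finset.mem_range.1 hi)
  · intro a _
    rw [ZMod.natCast_zmod_val]

theorem dist_le_rigidityDefect {X : Type*} [MetricSpace X] [CompactSpace X] (T : X → X)
    {q M t : ℕ} (ht : t < M) (x : X) : dist x (T^[t * q] x) ≤ rigidityDefect T q M := by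
  have hb : ∀ i : Fin M, BddAbove (Set.range fun x : X => dist x (T^[(i : ℕ) * q] x)) := by
    intro i
    refine ⟨Metric.diam (Set.univ : Set X), ?_⟩
    rintro _ ⟨y, rfl⟩
    exact Metric.dist_le_diam_of_mem isCompact_univ.isBounded (Set.mem_univ _) (Set.mem_univ _)
  exact (le_ciSup (hb ⟨t, ht⟩) x).trans
    (le_ciSup (f := fun i : Fin M => ⨆ x : X, dist x (T^[(i : ℕ) * q] x))
      (Set.finite_range _).bddAbove ⟨t, ht⟩)

theorem eventually_norm_sub_le_of_rigid {X : Type*} [MetricSpace X] [CompactSpace X] {T : X → X}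
    {q M : ℕ → ℕ} (h : Tendsto (fun n => rigidityDefect T (q n) (M n)) atTop (𝓝 0))
    (f : C(X, ℂ)) {η : ℝ} (hη : 0 < η) :
    ∀ᶠ n in atTop, ∀ t < M n, ∀ x, ‖f (T^[t * q n] x) - f x‖ ≤ η := by
  obtain ⟨ρ, hρ, hf⟩ := Metric.uniformContinuous_iff.1
    (CompactSpace.uniformContinuous_of_continuous f.continuous) η hη
  filter_upwards [h.eventually_lt_const hρ] with n hn t ht x
  rw [← dist_eq_norm, dist_comm]
  exact (hf ((dist_le_rigidityDefect T ht x).trans_lt hn)).le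

/-- The orbit function `N ↦ f (T^N x)` is nearly `q`-periodic at a rigidity time `q`. -/
theorem norm_iterate_sub_val_le {X : Type*} {T : X → X} {f : X → ℂ} {q M : ℕ} [NeZero q] {η : ℝ}
    (h : ∀ t < M, ∀ x, ‖f (T^[t * q] x) - f x‖ ≤ η) (x : X) {N : ℕ} (hN : N < M * q) :
    ‖f (T^[N] x) - f (T^[(N : ZMod q).val] x)‖ ≤ η := by
  have h1 := h (N / q) ((Nat.div_lt_iff_lt_mul (NeZero.pos q)).2 hN) (T^[N % q] x)
  rw [← Function.iterate_add_apply, mul_comm, Nat.div_add_mod] at h1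
  rwa [ZMod.val_natCast]

theorem norm_sum_le_norm_sum_add {ι : Type*} (s : Finset ι) (a b : ι → ℂ) {η : ℝ}
    (h : ∀ i ∈ s, ‖a i - b i‖ ≤ η) : ‖∑ i ∈ s, a i‖ ≤ ‖∑ i ∈ s, b i‖ + s.card * η := by
  have h1 : ‖∑ i ∈ s, (a i - b i)‖ ≤ s.card * η := by
    refine (norm_sum_le_of_le s h).trans_eq ?_
    simp
  have h2 : ∑ i ∈ s, a i = ∑ i ∈ s, b i + ∑ i ∈ s, (a i - b i) := by
    rw [Finset.sum_sub_distrib]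
    ring
  rw [h2]
  exact (norm_add_le _ _).trans (by gcongr)

/-- Some member of a rigidity sequence with boundedly many prime factors gives a small average
along `C`-th powers, uniformly in the starting point. -/
theorem exists_norm_sum_iterate_pow_le {X : Type*} [MetricSpace X] [CompactSpace X]
    [MeasurableSpace X] [BorelSpace X] {T : X → X} (hTc : Continuous T)
    (hT : IsTotallyUniquelyErgodic T) {μ : Measure X} [IsProbabilityMeasure μ]
    (hμ : MeasurePreserving T μ μ) {C : ℕ} (hC : 2 ≤ C) {k : ℕ} {q : ℕ → ℕ} (hq : StrictMono q)
    (hω : ∀ n, (q n).primeFactors.card ≤ k)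
    (hrigid : Tendsto (fun n => rigidityDefect T (q n) (q n ^ (C - 1))) atTop (𝓝 0))
    (f : C(X, ℂ)) (hf : ∫ y, f y ∂μ = 0) {ε : ℝ} (hε : 0 < ε) :
    ∃ n, 0 < q n ∧ ∀ x, ‖∑ i ∈ Finset.range (q n), f (T^[i ^ C] x)‖ ≤ ε * q n := by
  obtain ⟨φ, S, hφ, hSA, hesc⟩ := exists_subseq_finset_escape k (fun n => (q n).primeFactors) hω
  have hS : ∀ p ∈ S, p ≠ 0 := fun p hp => by
    obtain ⟨n, hn⟩ := hSA p hp
    exact (Nat.prime_of_mem_primeFactors hn).ne_zero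
  obtain ⟨Dmax, H, P, η, hH, hη, hmain⟩ := exists_params_norm_sum_zmod_pow_le S hS
    (n := C) (by omega) k (norm_nonneg f) (half_pos hε)
  set η' := min (η / 2) (ε / 2) with hη'
  have hη'0 : 0 < η' := lt_min (half_pos hη) (half_pos hε)
  have hrig := eventually_norm_sub_le_of_rigid (hrigid.comp hφ.tendsto_atTop) f hη'0
  have hqtop : Tendsto (q ∘ φ) atTop atTop := (hq.comp hφ).tendsto_atTop
  -- `Q` is fixed before `r`. As `C ≥ 2`, `Q > H * Dmax` gives `h * D < Q ^ (C - 1)`, so rigidity at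
  -- `Q` covers all shifts `h * D * Q`.
  obtain ⟨n₀, hrig₀, hn₀⟩ := (hrig.and (hqtop.eventually_gt_atTop (H * Dmax))).exists
  simp only [Function.comp_apply] at hrig₀ hn₀
  generalize q (φ n₀) = Q at hrig₀ hn₀
  have hQ0 : 0 < Q := by omega
  have hbirk : ∀ D ∈ Finset.Icc 1 Dmax, ∀ᶠ L in atTop, ∀ x : X,
      ‖∑ t ∈ Finset.range L, f ((T^[D])^[t] x)‖ ≤ η / 2 * L := by
    intro D hD
    obtain ⟨L₀, hL₀⟩ := (hT D (Finset.mem_Icc.1 hD).1).birkhoff_uniform (hTc.iterate D)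
      (hμ.iterate D) f (half_pos hη)
    filter_upwards [eventually_ge_atTop L₀] with L hL x
    simpa [hf] using hL₀ L hL x
  have hbirk' := hqtop.eventually ((Finset.eventually_all _).2 hbirk)
  -- The prime bound makes the shifts `h * (Q * D)` units modulo `m`. The two size bounds keep `a +
  -- h * (Q * D)` and `a + D * i` below `r * r ≤ r ^ (C - 1) * r`, the range of near periodicity.
  obtain ⟨n, hrign, hPn, hbn, hn1, hn2⟩ := (hrig.and ((hesc (P + H * (Q * Dmax) + 1)).and
    (hbirk'.and ((hqtop.eventually_gt_atTop (H * (Q * Dmax))).and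
      (hqtop.eventually_gt_atTop (Dmax + 2)))))).exists
  simp only [Function.comp_apply] at hrign hPn hbn hn1 hn2
  refine ⟨φ n, by omega, fun x => ?_⟩
  have hk := hω (φ n)
  generalize q (φ n) = r at *
  have hr0 : NeZero r := ⟨by omega⟩
  have hrC : r * r ≤ r ^ (C - 1) * r :=
    Nat.mul_le_mul_right r (Nat.le_self_pow (by omega) r)
  have hQC : Q ≤ Q ^ (C - 1) := Nat.le_self_pow (by omega) Q
  obtain ⟨s, m, hsm, hcop, hsS, hmS⟩ := Nat.exists_eq_mul_primeFactors_subset S (q := r) (by omega)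
  have hmr : m.primeFactors ⊆ r.primeFactors :=
    Nat.primeFactors_mono ⟨s, by rw [hsm, mul_comm]⟩ (by omega)
  have hη1 : η' ≤ η / 2 := min_le_left _ _
  have hη2 : η' ≤ ε / 2 := min_le_right _ _
  have hG := hmain r s m hsm hcop hsS ((Finset.card_le_card hmr).trans hk) Q hQ0
    (fun p hp => by
      have := hPn p (hmr hp) (hmS p hp)
      omega)
    (fun a => f (T^[a.val] x)) (fun a => f.norm_coe_le_norm _) ?_
  · rw [ZMod.sum_eq_sum_range] at hG
    have h1 := norm_sum_le_norm_sum_add (Finset.range r) (fun i => f (T^[i ^ C] x))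
      (fun i => f (T^[((i : ZMod r) ^ C).val] x)) (η := η') fun i hi => by
        rw [← Nat.cast_pow]
        refine norm_iterate_sub_val_le hrign x ?_
        rw [← pow_succ, Nat.sub_add_cancel (by omega)]
        exact Nat.pow_lt_pow_left (Finset.mem_range.1 hi) (by omega)
    rw [Finset.card_range] at h1
    have h2 : (r : ℝ) * η' ≤ r * (ε / 2) := by gcongr
    linarith
  · intro D hD hDle
    refine ⟨fun h hh a => ?_, fun a => ?_⟩
    · have hv : h * (Q * D) ≤ H * (Q * Dmax) := by gcongr
      have ha := ZMod.val_lt a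
      have h3 := norm_iterate_sub_val_le hrign x (N := a.val + h * (Q * D)) (by nlinarith)
      have hhD : h * D < Q ^ (C - 1) := by
        have : h * D ≤ H * Dmax := by gcongr
        omega
      have h4 := hrig₀ (h * D) hhD (T^[a.val] x)
      rw [← Function.iterate_add_apply, show h * D * Q + a.val = a.val + h * (Q * D) by ring] at h4
      rw [Nat.cast_add, ZMod.natCast_zmod_val] at h3
      rw [norm_sub_rev] at h3
      have h5 := norm_sub_le_norm_sub_add_norm_sub
        (f (T^[(a + ((h * (Q * D) : ℕ) : ZMod r)).val] x)) (f (T^[a.val + h * (Q * D)] x))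
        (f (T^[a.val] x))
      linarith
    · rw [ZMod.sum_eq_sum_range]
      have h6 := norm_sum_le_norm_sum_add (Finset.range r)
        (fun i => f (T^[(a + (D : ZMod r) * (i : ZMod r)).val] x))
        (fun i => f ((T^[D])^[i] (T^[a.val] x))) (η := η') fun i hi => by
          have hi' := Finset.mem_range.1 hi
          have ha := ZMod.val_lt a
          have h7 := norm_iterate_sub_val_le hrign x (N := a.val + D * i) (by
            have : D * i ≤ Dmax * r := by gcongr
            nlinarith)
          rw [Nat.cast_add, ZMod.natCast_zmod_val, Nat.cast_mul, norm_sub_rev, add_comm a.val,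
            Function.iterate_add_apply, Function.iterate_mul] at h7
          exact h7
      have h8 := hbn D (Finset.mem_Icc.2 ⟨hD, hDle⟩) (T^[a.val] x)
      rw [Finset.card_range] at h6
      have h9 : (r : ℝ) * η' ≤ r * (η / 2) := by gcongr
      linarith

/-- One good index in every admissible sequence is enough: if uniform convergence failed, the bad
indices would form a subsequence satisfying the same hypotheses. -/
theorem tendstoUniformly_average_iterate_pow {X : Type*} [MetricSpace X] [CompactSpace X]
    [MeasurableSpace X] [BorelSpace X] {T : X → X} (hTc : Continuous T)
    (hT : IsTotallyUniquelyErgodic T) {μ : Measure X} [IsProbabilityMeasure μ]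
    (hμ : MeasurePreserving T μ μ) {C : ℕ} (hC : 2 ≤ C) {k : ℕ} {q : ℕ → ℕ} (hq : StrictMono q)
    (hω : ∀ n, (q n).primeFactors.card ≤ k)
    (hrigid : Tendsto (fun n => rigidityDefect T (q n) (q n ^ (C - 1))) atTop (𝓝 0))
    (f : C(X, ℂ)) :
    TendstoUniformly
      (fun (n : ℕ) (x : X) => (1 / (q n : ℂ)) * ∑ i ∈ Finset.range (q n), f (T^[i ^ C] x))
      (fun _ : X => ∫ y, f y ∂μ) atTop := by
  rw [Metric.tendstoUniformly_iff]
  intro ε hε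
  by_contra hcon
  rw [not_eventually] at hcon
  obtain ⟨φ, hφ, hbad⟩ := extraction_of_frequently_atTop hcon
  have hfi : Integrable f μ := f.continuous.integrable_of_hasCompactSupport
    (HasCompactSupport.of_compactSpace f)
  set I := ∫ y, f y ∂μ with hI
  have hint : ∫ y, (f - ContinuousMap.const X I) y ∂μ = 0 := by
    simp only [ContinuousMap.sub_apply, ContinuousMap.const_apply]
    rw [integral_sub hfi (integrable_const _)]
    simp [hI]
  obtain ⟨n, hn, hsum⟩ := exists_norm_sum_iterate_pow_le hTc hT hμ hC (hq.comp hφ)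
    (fun n => hω (φ n)) (hrigid.comp hφ.tendsto_atTop) _ hint (half_pos hε)
  refine hbad n fun x => ?_
  have h1 := hsum x
  simp only [Function.comp_apply, ContinuousMap.sub_apply, ContinuousMap.const_apply,
    Finset.sum_sub_distrib, Finset.sum_const, Finset.card_range, nsmul_eq_mul] at h1 hn
  generalize q (φ n) = r at *
  have hr : (0 : ℝ) < r := by exact_mod_cast hn
  have hr' : (r : ℂ) ≠ 0 := by exact_mod_cast hn.ne'
  rw [dist_comm, dist_eq_norm]
  have h2 : 1 / (r : ℂ) * ∑ i ∈ Finset.range r, f (T^[i ^ C] x) - I =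
      (r : ℂ)⁻¹ * (∑ i ∈ Finset.range r, f (T^[i ^ C] x) - r * I) := by
    field_simp
  rw [h2, norm_mul, norm_inv, Complex.norm_natCast]
  calc (r : ℝ)⁻¹ * ‖∑ i ∈ Finset.range r, f (T^[i ^ C] x) - r * I‖
      ≤ (r : ℝ)⁻¹ * (ε / 2 * r) := by gcongr
    _ = ε / 2 := by field_simp
    _ < ε := half_lt_self hε

/-! ### From equidistribution to orbit closures. -/

/-- If averages of continuous functions along a set of points converge to their integrals, then
the closure of the set contains the support of the measure. -/
theorem support_subset_closure_range_of_tendsto {X : Type*} [MetricSpace X] [CompactSpace X]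
    [MeasurableSpace X] [BorelSpace X] {μ : Measure X} [IsProbabilityMeasure μ] (z : ℕ → X)
    (q : ℕ → ℕ)
    (h : ∀ f : C(X, ℂ), Tendsto (fun n => (1 / (q n : ℂ)) * ∑ i ∈ Finset.range (q n), f (z i))
      atTop (𝓝 (∫ y, f y ∂μ))) :
    μ.support ⊆ closure (Set.range z) := by
  intro y hy
  by_contra hyc
  -- The distance to the closure vanishes at every `z i`, yet has positive integral if a support
  -- point lies outside.
  let g : X → ℝ := fun w => Metric.infDist w (closure (Set.range z))
  have hg : Continuous g := Metric.continuous_infDist_pt _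
  have hgi : Integrable g μ := hg.integrable_of_hasCompactSupport
    (HasCompactSupport.of_compactSpace g)
  have hne : (closure (Set.range z)).Nonempty := (Set.range_nonempty z).closure
  have hpos : 0 < ∫ w, g w ∂μ := by
    rw [integral_pos_iff_support_of_nonneg (fun w => Metric.infDist_nonneg) hgi]
    refine (Measure.mem_support_iff_forall y).1 hy _ ?_
    refine hg.isOpen_support.mem_nhds ?_
    exact ((isClosed_closure.notMem_iff_infDist_pos hne).1 hyc).ne'
  have h1 := h ⟨fun w => (g w : ℂ), Complex.continuous_ofReal.comp hg⟩
  have h2 : ∀ i, g (z i) = 0 := fun i =>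
    Metric.infDist_zero_of_mem (subset_closure (Set.mem_range_self i))
  simp only [ContinuousMap.coe_mk, h2, Complex.ofReal_zero, Finset.sum_const_zero, mul_zero,
    integral_complex_ofReal] at h1
  have h3 := tendsto_nhds_unique h1 tendsto_const_nhds
  exact hpos.ne' (by exact_mod_cast h3)

theorem theorem1p2 {X : Type*} [MetricSpace X] [CompactSpace X] [MeasurableSpace X]
    [BorelSpace X] (T : X ≃ₜ X) (hT : IsTotallyUniquelyErgodic T)
    (μ : Measure X) [IsProbabilityMeasure μ] (hμ : MeasurePreserving T μ μ)
    (C : ℕ) (hC : 2 ≤ C) (k : ℕ) (q : ℕ → ℕ) (hq : StrictMono q)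
    (hω : ∀ n, ArithmeticFunction.cardDistinctFactors (q n) ≤ k)
    (hrigid : Tendsto (fun n => rigidityDefect T (q n) (q n ^ (C - 1))) atTop (𝓝 0)) :
    (∀ f : C(X, ℂ),
      TendstoUniformly
        (fun (n : ℕ) (x : X) => (1 / (q n : ℂ)) * ∑ i ∈ Finset.range (q n), f (T^[i ^ C] x))
        (fun _ : X => ∫ y, f y ∂μ) atTop) ∧
    (∀ x : X, μ.support ⊆ closure (Set.range fun n : ℕ => T^[n ^ C] x)) ∧
    (μ.IsOpenPosMeasure → ∀ x : X, Dense (Set.range fun n : ℕ => T^[n ^ C] x)) := by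
  have hω' : ∀ n, (q n).primeFactors.card ≤ k := fun n => by
    have h := hω n
    rwa [ArithmeticFunction.cardDistinctFactors_apply, ← List.card_toFinset] at h
  have hunif := tendstoUniformly_average_iterate_pow T.continuous hT hμ hC hq hω' hrigid
  have hsupp : ∀ x : X, μ.support ⊆ closure (Set.range fun n : ℕ => T^[n ^ C] x) := fun x =>
    support_subset_closure_range_of_tendsto (fun n : ℕ => T^[n ^ C] x) q fun f =>
      (hunif f).tendsto_at x
  refine ⟨hunif, hsupp, fun hpos x y => hsupp x ?_⟩
  rw [Measure.support_eq_univ]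
  exact Set.mem_univ y
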